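/- Let $\mathfrak g$ be a finite-dimensional complex simple Lie algebra of rank $\ell$ of type $B_\ell$ ($\ell\ge2$), $C_\ell$ ($\ell\ge2$), $F_4$ or $G_2$, let $I=\{1,\dots,\ell\}$, and let $C=(C_{ij})$ be its Cartan matrix, $C_{ij}=2(\alpha_i,\alpha_j)/(\alpha_i,\alpha_i)$. Put $d_i=\tfrac12(\alpha_i,\alpha_i)$, $d=\min_i d_i$, $d'=\max_i d_i$, normalized and labelled as follows: $B_\ell$: $d_i=1$ for $i<\ell$, $d_\ell=\tfrac12$; $C_\ell$: $d_i=1$ for $i<\ell$, $d_\ell=2$; $F_4$: $d_1=d_2=1$, $d_3=d_4=\tfrac12$; $G_2$: $d_1=1$, $d_2=3$ (in each case the Dynkin diagram is the path $1-2-\cdots-\ell$). Fix an integer $m>1$ and let $\mathcal Y_m=\mathbb C(y_i(n);\ i\in I,\ n\in d\mathbb Z/d'm\mathbb Z)$ be the rational function field in these variables. With the convention $y_0(n)=y_{\ell+1}(n)=1$, put $$F_i(n)=\begin{cases} y_{i-1}(n+\tfrac12)\,y_{i+1}(n) & (\mathfrak g,i)=(B_\ell,\ell),(F_4,3),\\ y_{i-1}(n+1)\,y_{i+1}(n)\,y_{i+1}(n+\tfrac12)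 & (\mathfrak g,i)=(B_\ell,\ell-1),(F_4,2),\\ y_{\ell-1}(n+1)\,y_{\ell-1}(n+2) & (\mathfrak g,i)=(C_\ell,\ell),\\ y_1(n+1)\,y_1(n+2)\,y_1(n+3) & (\mathfrak g,i)=(G_2,2),\\ \prod_{j<i,\,C_{ij}\ne0}y_j(n+d_j)\prod_{j>i,\,C_{ij}\ne0}y_j(n) & \text{otherwise,} \end{cases}$$ $$X_i(n)=\frac{F_i(n)}{y_i(n)\,y_i(n+d_i)},\qquad P_i(n)=1+\sum_{k=0}^{d'm/d_i-2}X_i(n)X_i(n-d_i)\cdots X_i(n-kd_i),\qquad z_i(n)=y_i(n)+\frac{F_i(n)}{y_i(n+d_i)},$$ and $\mathcal Z_m^{(i)}=\mathbb C(z_i(n),\,y_j(n);\ j\in I\setminus\{i\},\ n\in d\mathbb Z/d'm\mathbb Z)\subset\mathcal Y_m$. Fix $i\in I$, let $\Sigma_i=\{s\in\mathbb Z:\ 1\le s\le d_i/d\}$, and for $s\in\Sigma_i$ let $N_{i,s}=(d_i\mathbb Z+(s-1)d)/d'm\mathbb Z\subset d\mathbb Z/d'm\mathbb Z$ and $$\boldsymbol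 y_{i,s}=\prod_{n\in N_{i,s}}y_i(n),\qquad \boldsymbol F_{i,s}=\prod_{n\in N_{i,s}}F_i(n),\qquad \delta_{i,s}=\boldsymbol y_{i,s}-\frac{\boldsymbol F_{i,s}}{\boldsymbol y_{i,s}}.$$ Then for each $s\in\Sigma_i$ there is a unique $\mathbb C$-algebra automorphism $r_{i,s}$ of $\mathcal Y_m$ such that $$r_{i,s}(y_j(n))=\begin{cases}\dfrac{P_i(n-2d_i)}{P_i(n-d_i)}\,y_i(n)\,X_i(n-d_i) & j=i,\ n\in N_{i,s},\\[1mm] y_j(n)&\text{otherwise.}\end{cases}$$ The $r_{i,s}$ ($s\in\Sigma_i$) commute and have order two, and for the group $R_i$ of automorphisms of $\mathcal Y_m$ that they generate, $(\epsilon_s)_s\mapsto\prod_s r_{i,s}^{\epsilon_s}$ is an isomorphism $(\mathbb Z/2\mathbb Z)^{\Sigma_i}\cong R_i$. The $R_i$-invariant subfield of $\mathcal Y_m$ is $\mathcal Z_m^{(i)}$, and the extension $\mathcal Y_m/\mathcal Z_m^{(i)}$ is Galois with group $R_i$. Moreover $\mathcal Y_m=\mathcal Z_m^{(i)}(\delta_{i,s};\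 s\in\Sigma_i)$, and for every $s\in\Sigma_i$ we have $\delta_{i,s}^2\in\mathcal Z_m^{(i)}$ and $r_{i,s}(\delta_{i,s})=-\delta_{i,s}$. -/

import Mathlib

noncomputable section

/-- The Dynkin types of the finite-dimensional complex simple Lie algebras that are not
simply laced. -/
inductive NSLType : Type
  | B (l : ℕ) (hl : 2 ≤ l) : NSLType
  | C (l : ℕ) (hl : 2 ≤ l) : NSLType
  | F4 : NSLType
  | G2 : NSLType

namespace NSLType

/-- The rank `ℓ`. -/
def rank : NSLType → ℕ
  | B l _ => l
  | C l _ => l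
  | F4 => 4
  | G2 => 2

/-- The index set `I = {1, …, ℓ}` of the simple roots; the element `i : Fin ℓ` stands for the
vertex with label `i + 1`. -/
abbrev I (T : NSLType) : Type := Fin T.rank

/-- The label in `{1, …, ℓ}` of a vertex. -/
def label (T : NSLType) (i : T.I) : ℕ := i.val + 1

/-- The Cartan matrix `C_{ij} = 2 (α_i, α_j) / (α_i, α_i)`. (For the types `B`, `C`, `F₄` this is
the transpose of Mathlib's matrix, see `sqLen_mul_cartan`.) -/
def cartan : (T : NSLType) → Matrix T.I T.I ℤ
  | B l _ => (CartanMatrix.B l).transpose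
  | C l _ => (CartanMatrix.C l).transpose
  | F4 => CartanMatrix.F₄.transpose
  | G2 => CartanMatrix.G₂

/-- `d_i = (α_i, α_i) / 2`. -/
def sqLen : (T : NSLType) → T.I → ℚ
  | B l _, i => if i.val + 1 = l then 1 / 2 else 1
  | C l _, i => if i.val + 1 = l then 2 else 1
  | F4, i => if i.val + 1 ≤ 2 then 1 else 1 / 2
  | G2, i => if i.val + 1 = 1 then 1 else 3

/-- `d = min {d_i}`. -/
def dmin : NSLType → ℚ
  | B _ _ => 1 / 2
  | C _ _ => 1
  | F4 => 1 / 2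
  | G2 => 1

/-- `d' = max {d_i}`. -/
def dmax : NSLType → ℚ
  | B _ _ => 1
  | C _ _ => 2
  | F4 => 1
  | G2 => 3

/-- The integer `c = d' / d`. -/
def c : NSLType → ℕ
  | B _ _ => 2
  | C _ _ => 2
  | F4 => 2
  | G2 => 3

/-- The integer `d_i / d`. -/
def e : (T : NSLType) → T.I → ℕ
  | B l _, i => if i.val + 1 = l then 1 else 2
  | C l _, i => if i.val + 1 = l then 2 else 1
  | F4, i => if i.val + 1 ≤ 2 then 2 else 1
  | G2, i => if i.val + 1 = 1 then 1 else 3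

theorem sqLen_mul_cartan (T : NSLType) (i j : T.I) :
    T.sqLen i * T.cartan i j = T.sqLen j * T.cartan j i := by
  cases T with
  | B l hl =>
    change Fin l at i j
    simp only [sqLen, cartan, CartanMatrix.B, Matrix.transpose_apply, Matrix.of_apply]
    rcases i with ⟨i, hi⟩
    rcases j with ⟨j, hj⟩
    simp only [Fin.mk.injEq]
    split_ifs <;> first | omega | norm_num
  | C l hl =>
    change Fin l at i j
    simp only [sqLen, cartan, CartanMatrix.C, Matrix.transpose_apply, Matrix.of_apply]
    rcases i with ⟨i, hi⟩
    rcases j with ⟨j, hj⟩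
    simp only [Fin.mk.injEq]
    split_ifs <;> first | omega | norm_num
  | F4 =>
    change Fin 4 at i j
    fin_cases i <;> fin_cases j <;> simp [sqLen, cartan, CartanMatrix.F₄]
  | G2 =>
    change Fin 2 at i j
    fin_cases i <;> fin_cases j <;> simp [sqLen, cartan, CartanMatrix.G₂]

theorem isLeast_dmin (T : NSLType) : IsLeast (Set.range T.sqLen) T.dmin := by
  cases T with
  | B l hl =>
    refine ⟨⟨(⟨l - 1, by omega⟩ : Fin l), ?_⟩, ?_⟩
    · simp only [sqLen, dmin]
      rw [if_pos (by omega)]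
    · rintro _ ⟨i, rfl⟩
      simp only [sqLen, dmin]
      split_ifs <;> norm_num
  | C l hl =>
    refine ⟨⟨(⟨0, by omega⟩ : Fin l), ?_⟩, ?_⟩
    · simp only [sqLen, dmin]
      rw [if_neg (by omega)]
    · rintro _ ⟨i, rfl⟩
      simp only [sqLen, dmin]
      split_ifs <;> norm_num
  | F4 =>
    refine ⟨⟨(3 : Fin 4), by simp [sqLen, dmin]⟩, ?_⟩
    rintro _ ⟨i, rfl⟩
    simp only [sqLen, dmin]
    split_ifs <;> norm_num
  | G2 =>
    refine ⟨⟨(0 : Fin 2), by simp [sqLen, dmin]⟩, ?_⟩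
    rintro _ ⟨i, rfl⟩
    simp only [sqLen, dmin]
    split_ifs <;> norm_num

theorem isGreatest_dmax (T : NSLType) : IsGreatest (Set.range T.sqLen) T.dmax := by
  cases T with
  | B l hl =>
    refine ⟨⟨(⟨0, by omega⟩ : Fin l), ?_⟩, ?_⟩
    · simp only [sqLen, dmax]
      rw [if_neg (by omega)]
    · rintro _ ⟨i, rfl⟩
      simp only [sqLen, dmax]
      split_ifs <;> norm_num
  | C l hl =>
    refine ⟨⟨(⟨l - 1, by omega⟩ : Fin l), ?_⟩, ?_⟩
    · simp only [sqLen, dmax]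
      rw [if_pos (by omega)]
    · rintro _ ⟨i, rfl⟩
      simp only [sqLen, dmax]
      split_ifs <;> norm_num
  | F4 =>
    refine ⟨⟨(0 : Fin 4), by simp [sqLen, dmax]⟩, ?_⟩
    rintro _ ⟨i, rfl⟩
    simp only [sqLen, dmax]
    split_ifs <;> norm_num
  | G2 =>
    refine ⟨⟨(1 : Fin 2), by simp [sqLen, dmax]⟩, ?_⟩
    rintro _ ⟨i, rfl⟩
    simp only [sqLen, dmax]
    split_ifs <;> norm_num

theorem dmax_eq (T : NSLType) : T.dmax = T.c * T.dmin := by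
  cases T <;> norm_num [dmax, c, dmin]

theorem sqLen_eq (T : NSLType) (i : T.I) : T.sqLen i = T.e i * T.dmin := by
  cases T <;> simp only [sqLen, e, dmin] <;> split_ifs <;> norm_num

theorem e_dvd_c (T : NSLType) (i : T.I) : T.e i ∣ T.c := by
  cases T <;> simp only [e, c] <;> split_ifs <;> norm_num

/-- The group `dℤ / d'mℤ`, through the isomorphism `ℤ / cmℤ ≃ dℤ / d'mℤ` given by `k ↦ d k`
(recall `d' = c d`). So a shift by `d` is a shift by `1` here, and a shift by `d_i` is a shift
by `e i`. -/
abbrev Idx (T : NSLType) (m : ℕ) : Type := ZMod (T.c * m)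

/-- The rational function field `𝒴_m` over `ℂ` in the variables `y_i(n)`. -/
abbrev Y (T : NSLType) (m : ℕ) : Type := FractionRing (MvPolynomial (T.I × T.Idx m) ℂ)

/-- The variable `y_i(n)`. -/
def y (T : NSLType) (m : ℕ) (i : T.I) (n : T.Idx m) : T.Y m :=
  algebraMap (MvPolynomial (T.I × T.Idx m) ℂ) (T.Y m) (MvPolynomial.X (i, n))

/-- The variable `y_a(n)` for a label `a ∈ {1, …, ℓ}`; it is `1` for other `a`. -/
def yl (T : NSLType) (m : ℕ) (a : ℕ) (n : T.Idx m) : T.Y m :=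
  if h : 1 ≤ a ∧ a ≤ T.rank then T.y m ⟨a - 1, by omega⟩ n else 1

/-- The generic formula for `F_i(n)`:
`∏_{j < i, C_{ij} ≠ 0} y_j(n + d_j) ∏_{j > i, C_{ij} ≠ 0} y_j(n)`. -/
def Fgen (T : NSLType) (m : ℕ) (i : T.I) (n : T.Idx m) : T.Y m :=
  (∏ j : T.I with j < i ∧ T.cartan i j ≠ 0, T.y m j (n + (T.e j : T.Idx m))) *
    ∏ j : T.I with i < j ∧ T.cartan i j ≠ 0, T.y m j n

/-- `F_i(n)`. For the types `B` and `F₄`, where `d = 1/2`, the shifts by `1/2` and by `1` are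
`n + 1` and `n + 2`. -/
def F : (T : NSLType) → (m : ℕ) → (i : T.I) → (n : T.Idx m) → T.Y m
  | B l hl, m, i, n =>
    let T := B l hl
    let a := T.label i
    if a = l then T.yl m (a - 1) (n + 1) * T.yl m (a + 1) n
    else if a = l - 1 then
      T.yl m (a - 1) (n + 2) * T.yl m (a + 1) n * T.yl m (a + 1) (n + 1)
    else T.Fgen m i n
  | C l hl, m, i, n =>
    let T := C l hl
    let a := T.label i
    if a = l then T.yl m (l - 1) (n + 1) * T.yl m (l - 1) (n + 2)
    else T.Fgen m i n
  | F4, m, i, n =>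
    let T := F4
    let a := T.label i
    if a = 3 then T.yl m (a - 1) (n + 1) * T.yl m (a + 1) n
    else if a = 2 then
      T.yl m (a - 1) (n + 2) * T.yl m (a + 1) n * T.yl m (a + 1) (n + 1)
    else T.Fgen m i n
  | G2, m, i, n =>
    let T := G2
    let a := T.label i
    if a = 2 then T.yl m 1 (n + 1) * T.yl m 1 (n + 2) * T.yl m 1 (n + 3)
    else T.Fgen m i n

/-- `X_i(n) = F_i(n) / (y_i(n) y_i(n + d_i))`. -/
def X (T : NSLType) (m : ℕ) (i : T.I) (n : T.Idx m) : T.Y m :=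
  T.F m i n / (T.y m i n * T.y m i (n + (T.e i : T.Idx m)))

/-- The integer `d'm / d_i`. -/
def len (T : NSLType) (m : ℕ) (i : T.I) : ℕ := T.c * m / T.e i

theorem len_mul_e (T : NSLType) (m : ℕ) (i : T.I) : T.len m i * T.e i = T.c * m :=
  Nat.div_mul_cancel ((T.e_dvd_c i).mul_right m)

/-- `P_i(n) = 1 + ∑_{k=0}^{d'm/d_i - 2} X_i(n) X_i(n - d_i) ⋯ X_i(n - d_i k)`. -/
def P (T : NSLType) (m : ℕ) (i : T.I) (n : T.Idx m) : T.Y m :=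
  1 + ∑ k ∈ Finset.range (T.len m i - 1), ∏ p ∈ Finset.range (k + 1),
    T.X m i (n - (p : T.Idx m) * (T.e i : T.Idx m))

/-- `z_i(n) = y_i(n) + F_i(n) / y_i(n + d_i)`. -/
def z (T : NSLType) (m : ℕ) (i : T.I) (n : T.Idx m) : T.Y m :=
  T.y m i n + T.F m i n / T.y m i (n + (T.e i : T.Idx m))

/-- The subfield `𝒵_m^{(i)} = ℂ(z_i(n), y_j(n) ; j ≠ i)` of `𝒴_m`. -/
def Z (T : NSLType) (m : ℕ) (i : T.I) : IntermediateField ℂ (T.Y m) :=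
  IntermediateField.adjoin ℂ
    ({w | ∃ n, w = T.z m i n} ∪ {w | ∃ j n, j ≠ i ∧ w = T.y m j n})

/-- The set `Σ_i = {1, …, d_i / d}`; the element `s : Fin (d_i / d)` stands for `s + 1`. -/
abbrev Sig (T : NSLType) (i : T.I) : Type := Fin (T.e i)

/-- `N_{i,s}`: the coset in `dℤ / d'mℤ` of the subgroup generated by `d_i` that contains
`(s - 1) d`, where `s` runs from `1` (the element `s : Sig i` stands for `s + 1`). -/
def N (T : NSLType) (m : ℕ) (i : T.I) (s : T.Sig i) : Finset (T.Idx m) :=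
  (Finset.range (T.len m i)).image fun t : ℕ => (t : T.Idx m) * (T.e i : T.Idx m) + (s.val : T.Idx m)

theorem mem_N (T : NSLType) (m : ℕ) (hm : 1 < m) (i : T.I) (s : T.Sig i) (n : T.Idx m) :
    n ∈ T.N m i s ↔ ∃ t : ℤ, n = (t : T.Idx m) * (T.e i : T.Idx m) + (s.val : T.Idx m) := by
  have hlen := T.len_mul_e m i
  have hc : 0 < T.c * m := by
    refine Nat.mul_pos ?_ (by omega)
    cases T <;> simp [c]
  have hl : 0 < T.len m i := Nat.pos_of_mul_pos_right (hlen ▸ hc)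
  simp only [N, Finset.mem_image, Finset.mem_range]
  constructor
  · rintro ⟨t, -, rfl⟩
    exact ⟨t, by push_cast; rfl⟩
  · rintro ⟨t, rfl⟩
    have hl0 : (0 : ℤ) < T.len m i := by exact_mod_cast hl
    have h1 := Int.emod_nonneg t hl0.ne'
    have h2 := Int.emod_lt_of_pos t hl0
    have h3 := Int.emod_add_mul_ediv t (T.len m i)
    refine ⟨(t % (T.len m i : ℤ)).toNat, by omega, ?_⟩
    have h4 : (((t % (T.len m i : ℤ)).toNat : ℕ) : T.Idx m)
        = ((t % (T.len m i : ℤ) : ℤ) : T.Idx m) := by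
      rw [← Int.cast_natCast, Int.toNat_of_nonneg h1]
    have h5 : ((T.len m i : ℕ) : T.Idx m) * ((T.e i : ℕ) : T.Idx m) = 0 := by
      rw [← Nat.cast_mul, hlen, ZMod.natCast_self]
    have h6 : (t : T.Idx m) = ((t % (T.len m i : ℤ) : ℤ) : T.Idx m)
        + (T.len m i : T.Idx m) * ((t / (T.len m i : ℤ) : ℤ) : T.Idx m) := by
      conv_lhs => rw [← h3]
      push_cast
      rfl
    rw [h4, h6]
    linear_combination (-((t / (T.len m i : ℤ) : ℤ) : T.Idx m)) * h5

/-- `𝐲_{i,s} = ∏_{n ∈ N_{i,s}} y_i(n)`. -/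
def bigY (T : NSLType) (m : ℕ) (i : T.I) (s : T.Sig i) : T.Y m :=
  ∏ n ∈ T.N m i s, T.y m i n

/-- `𝐅_{i,s} = ∏_{n ∈ N_{i,s}} F_i(n)`. -/
def bigF (T : NSLType) (m : ℕ) (i : T.I) (s : T.Sig i) : T.Y m :=
  ∏ n ∈ T.N m i s, T.F m i n

/-- `δ_{i,s} = 𝐲_{i,s} - 𝐅_{i,s} / 𝐲_{i,s}`. -/
def delta (T : NSLType) (m : ℕ) (i : T.I) (s : T.Sig i) : T.Y m :=
  T.bigY m i s - T.bigF m i s / T.bigY m i s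

/-- The defining property of the automorphism `r_{i,s}` of `𝒴_m`: its values on the variables. -/
def IsReflection (T : NSLType) (m : ℕ) (i : T.I) (s : T.Sig i)
    (ρ : T.Y m ≃ₐ[ℂ] T.Y m) : Prop :=
  ∀ (j : T.I) (n : T.Idx m), ρ (T.y m j n) =
    if j = i ∧ n ∈ T.N m i s then
      T.P m i (n - 2 * (T.e i : T.Idx m)) / T.P m i (n - (T.e i : T.Idx m)) * T.y m i n *
        T.X m i (n - (T.e i : T.Idx m))
    else T.y m j n

end NSLType

end

/-! Fix a coset `N_{i,s}` and put `u_t = y_i(n + t d_i)`. The definition of `z_i` reads `u_t + f_t /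
u_{t+1} = z_t`, with `f_t`, `z_t` in `Z`: a Möbius recursion, periodic of period `len`. One turn
around the cycle is a 2×2 matrix over `Z` with eigenvector `(u_0, 1)` and eigenvalue `∏ f_t /
u_{t+1} = F/y` (bold letters of the statement). The reflected variables `reflY` solve the same
recursion (`reflY_add_div`) and have eigenvalue `y` (`prod_reflY`). So `y + F/y` is the trace and
lies in `Z`, and `δ`, the difference of the eigenvalues, squares to the discriminant. An eigenvalue
determines its eigenvector rationally, so each `y_i(n)` lies in `Z(δ_{i,s})`, and the `δ_{i,s}`
generate `𝒴_m` over `Z`.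

The same argument, applied to the field generated by the reflected variables, shows that this field
is all of `𝒴_m`. A generating family with as many members as the transcendence degree is
algebraically independent, so the reflection exists as an automorphism (`exists_isReflection`). It
fixes `Z`, swaps the two eigenvalues on its own coset and leaves the other cosets alone; hence it
negates `δ_{i,s}` only.

The rest is the Galois theory of a field generated by square roots (`KummerTwo`). Independence of
the square roots needs no separate proof, since the reflections realize all sign changes. -/

noncomputable section

/-! ### Fields generated by square roots -/

namespace KummerTwo

variable {k K S : Type*} [Field k] [Field K] [Algebra k K]
  {Z : IntermediateField k K} {δ : S → K}

theorem algEquiv_ext (htop : IntermediateField.adjoin Z (Set.range δ) = ⊤) {σ τ : K ≃ₐ[k] K}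
    (hZ : ∀ x ∈ Z, σ x = τ x) (hδ : ∀ s, σ (δ s) = τ (δ s)) : σ = τ := by
  ext x
  have hx : x ∈ IntermediateField.adjoin Z (Set.range δ) := htop ▸ IntermediateField.mem_top
  induction hx using IntermediateField.adjoin_induction with
  | mem x hx => obtain ⟨s, rfl⟩ := hx; exact hδ s
  | algebraMap x => exact hZ x x.2
  | add x y _ _ hx hy => rw [map_add, map_add, hx, hy]
  | inv x _ hx => rw [map_inv₀, map_inv₀, hx]
  | mul x y _ _ hx hy => rw [map_mul, map_mul, hx, hy]

/-- Each generator is a root of `X² - δ² = (X - δ)(X + δ)`, which gives normality; separability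
comes from characteristic zero. -/
theorem isGalois [CharZero K] (hsq : ∀ s, δ s ^ 2 ∈ Z)
    (htop : IntermediateField.adjoin Z (Set.range δ) = ⊤) : IsGalois Z K := by
  have key : ∀ x ∈ Set.range δ, IsIntegral Z x ∧
      ((minpoly Z x).map (algebraMap Z K)).Splits := by
    rintro _ ⟨s, rfl⟩
    let p : Polynomial Z := Polynomial.X ^ 2 - Polynomial.C ⟨δ s ^ 2, hsq s⟩
    have hp : p.Monic := Polynomial.monic_X_pow_sub_C _ two_ne_zero
    have hroot : Polynomial.aeval (δ s) p = 0 := by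
      simp only [p, map_sub, map_pow, Polynomial.aeval_X, Polynomial.aeval_C]
      exact sub_self _
    have hmap : p.map (algebraMap Z K) =
        (Polynomial.X - Polynomial.C (δ s)) * (Polynomial.X + Polynomial.C (δ s)) := by
      have : algebraMap Z K ⟨δ s ^ 2, hsq s⟩ = δ s ^ 2 := rfl
      simp only [p, Polynomial.map_sub, Polynomial.map_pow, Polynomial.map_X, Polynomial.map_C,
        this, Polynomial.C_pow]
      ring
    refine ⟨⟨p, hp, hroot⟩, ?_⟩
    refine Polynomial.Splits.of_dvd (g := p.map (algebraMap Z K)) ?_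
      (Polynomial.map_ne_zero hp.ne_zero)
      (Polynomial.map_dvd _ (minpoly.dvd _ _ hroot))
    rw [hmap]
    exact (Polynomial.Splits.X_sub_C _).mul (Polynomial.Splits.X_add_C _)
  have hint : Algebra.IsIntegral Z K := by
    have : Algebra.IsAlgebraic Z (IntermediateField.adjoin Z (Set.range δ)) :=
      IntermediateField.isAlgebraic_adjoin fun x hx => (key x hx).1
    refine ⟨fun x => ?_⟩
    have hx : x ∈ IntermediateField.adjoin Z (Set.range δ) := htop ▸ IntermediateField.mem_top
    have := (Algebra.IsAlgebraic.isAlgebraic (R := Z)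
      (⟨x, hx⟩ : IntermediateField.adjoin Z (Set.range δ))).isIntegral
    exact this.map (IntermediateField.val _)
  have : CharZero Z := (algebraMap Z K).charZero
  have : Normal Z K := normal_iff.2 fun x => ⟨hint.isIntegral x,
    IntermediateField.splits_of_mem_adjoin _ _ key (htop ▸ IntermediateField.mem_top)⟩
  exact ⟨⟩

/-- The sign `(-1)^a`. -/
def sign (K : Type*) [Field K] (a : ZMod 2) : K := if a = 0 then 1 else -1

theorem sign_add (a b : ZMod 2) : sign K (a + b) = sign K a * sign K b := by
  have h : ∀ a : ZMod 2, a = 0 ∨ a = 1 := by decide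
  have h1 : (1 + 1 : ZMod 2) = 0 := by decide
  rcases h a with rfl | rfl <;> rcases h b with rfl | rfl <;> simp [sign, h1]

theorem sign_zero : sign K 0 = 1 := if_pos rfl

theorem sign_one : sign K 1 = -1 := if_neg (by decide)

theorem sign_injective [CharZero K] : Function.Injective (sign K) := by
  have h : ∀ a : ZMod 2, a = 0 ∨ a = 1 := by decide
  intro a b hab
  have h1 : (1 : K) ≠ -1 := by norm_num
  rcases h a with rfl | rfl <;> rcases h b with rfl | rfl <;>
    simp_all [sign_zero, sign_one, eq_comm]

theorem map_sign (σ : K ≃ₐ[k] K) (a : ZMod 2) : σ (sign K a) = sign K a := by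
  unfold sign; split_ifs <;> simp

variable {r : S → K ≃ₐ[k] K}

theorem commute [DecidableEq S] (htop : IntermediateField.adjoin Z (Set.range δ) = ⊤)
    (hrZ : ∀ s, ∀ x ∈ Z, r s x = x)
    (hr : ∀ s t, r s (δ t) = if s = t then -δ t else δ t) (s s' : S) :
    Commute (r s) (r s') := by
  refine algEquiv_ext htop (fun x hx => ?_) fun t => ?_
  · simp only [AlgEquiv.mul_apply, hrZ _ x hx]
  · simp only [AlgEquiv.mul_apply, hr]
    split_ifs <;> simp_all

theorem orderOf_eq_two [CharZero K] [DecidableEq S] (h0 : ∀ s, δ s ≠ 0)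
    (htop : IntermediateField.adjoin Z (Set.range δ) = ⊤)
    (hrZ : ∀ s, ∀ x ∈ Z, r s x = x)
    (hr : ∀ s t, r s (δ t) = if s = t then -δ t else δ t) (s : S) :
    orderOf (r s) = 2 := by
  refine orderOf_eq_prime ?_ fun h => ?_
  · rw [pow_two]
    refine algEquiv_ext htop (fun x hx => ?_) fun t => ?_
    · simp only [AlgEquiv.mul_apply, hrZ _ x hx, AlgEquiv.one_apply]
    · simp only [AlgEquiv.mul_apply, hr, AlgEquiv.one_apply]
      split_ifs with h <;> simp [hr, h]
  · have := hr s s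
    rw [h, if_pos rfl, AlgEquiv.one_apply] at this
    exact h0 s (self_eq_neg.1 this)

theorem closure_le_fixingSubgroup (hrZ : ∀ s, ∀ x ∈ Z, r s x = x) :
    Subgroup.closure (Set.range r) ≤ Z.fixingSubgroup := by
  rw [Subgroup.closure_le]
  rintro _ ⟨s, rfl⟩
  exact (IntermediateField.mem_fixingSubgroup_iff _ _).2 (hrZ s)

/-- Sign vectors add as automorphisms compose, because signs are fixed by every automorphism; a
single sign change at `t` is `r t`. -/
theorem exists_mem_closure [DecidableEq S] [Finite S]
    (hr : ∀ s t, r s (δ t) = if s = t then -δ t else δ t) (ε : S → ZMod 2) :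
    ∃ σ ∈ Subgroup.closure (Set.range r), ∀ s, σ (δ s) = sign K (ε s) * δ s := by
  induction ε using Pi.single_induction with
  | zero => exact ⟨1, one_mem _, fun s => by simp [sign_zero]⟩
  | add f g hf hg =>
    obtain ⟨σ, hσ, h⟩ := hf
    obtain ⟨τ, hτ, h'⟩ := hg
    refine ⟨σ * τ, mul_mem hσ hτ, fun s => ?_⟩
    rw [AlgEquiv.mul_apply, h', map_mul, map_sign, h, Pi.add_apply, sign_add]
    ring
  | single t a =>
    have h : ∀ a : ZMod 2, a = 0 ∨ a = 1 := by decide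
    rcases h a with rfl | rfl
    · exact ⟨1, one_mem _, fun s => by simp [sign_zero]⟩
    · refine ⟨r t, Subgroup.subset_closure ⟨t, rfl⟩, fun s => ?_⟩
      rw [hr]
      by_cases hts : t = s
      · subst hts; simp [sign_one]
      · rw [if_neg hts, Pi.single_eq_of_ne (Ne.symm hts), sign_zero, one_mul]

theorem exists_sign {σ : K ≃ₐ[k] K} (hsq : ∀ s, δ s ^ 2 ∈ Z) (hσ : σ ∈ Z.fixingSubgroup) :
    ∃ ε : S → ZMod 2, ∀ s, σ (δ s) = sign K (ε s) * δ s := by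
  have : ∀ s, ∃ a : ZMod 2, σ (δ s) = sign K a * δ s := fun s => by
    have h : σ (δ s) ^ 2 = δ s ^ 2 := by
      rw [← map_pow]; exact (IntermediateField.mem_fixingSubgroup_iff _ _).1 hσ _ (hsq s)
    rcases sq_eq_sq_iff_eq_or_eq_neg.1 h with h | h
    · exact ⟨0, by rw [h, sign_zero, one_mul]⟩
    · exact ⟨1, by rw [h, sign_one, neg_one_mul]⟩
  exact ⟨fun s => (this s).choose, fun s => (this s).choose_spec⟩

/-- An automorphism over `Z` is determined by its signs on the `δ s`, and every sign vector already
occurs in the closure. -/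
theorem fixingSubgroup_eq [DecidableEq S] [Finite S] (hsq : ∀ s, δ s ^ 2 ∈ Z)
    (htop : IntermediateField.adjoin Z (Set.range δ) = ⊤)
    (hrZ : ∀ s, ∀ x ∈ Z, r s x = x)
    (hr : ∀ s t, r s (δ t) = if s = t then -δ t else δ t) :
    Z.fixingSubgroup = Subgroup.closure (Set.range r) := by
  refine le_antisymm (fun σ hσ => ?_) (closure_le_fixingSubgroup hrZ)
  obtain ⟨ε, hε⟩ := exists_sign hsq hσ
  obtain ⟨τ, hτ, h⟩ := exists_mem_closure hr ε
  have hτ' := closure_le_fixingSubgroup hrZ hτ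
  rw [IntermediateField.mem_fixingSubgroup_iff] at hσ hτ'
  rwa [algEquiv_ext htop (fun x hx => (hσ x hx).trans (hτ' x hx).symm)
    fun s => (hε s).trans (h s).symm]

theorem fixedField_eq [CharZero K] [DecidableEq S] [Finite S] (hsq : ∀ s, δ s ^ 2 ∈ Z)
    (htop : IntermediateField.adjoin Z (Set.range δ) = ⊤)
    (hrZ : ∀ s, ∀ x ∈ Z, r s x = x)
    (hr : ∀ s t, r s (δ t) = if s = t then -δ t else δ t) :
    IntermediateField.fixedField (Subgroup.closure (Set.range r)) = Z := by
  have := isGalois hsq htop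
  rw [← fixingSubgroup_eq hsq htop hrZ hr]
  refine le_antisymm (fun x hx => ?_) fun x hx => ?_
  -- The group consists of `k`-automorphisms, so each `Z`-automorphism is first regarded over `k`.
  -- The infinite Galois correspondence avoids proving that the degree is finite.
  · have h := (InfiniteGalois.mem_range_algebraMap_iff_fixed (k := Z) (K := K) x).2 fun σ => by
      refine (IntermediateField.mem_fixedField_iff _ _).1 hx (σ.restrictScalars k) ?_
      exact (IntermediateField.mem_fixingSubgroup_iff _ _).2 fun z hz => σ.commutes ⟨z, hz⟩
    obtain ⟨z, rfl⟩ := h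
    exact z.2
  · refine (IntermediateField.mem_fixedField_iff _ _).2 fun σ hσ => ?_
    exact (IntermediateField.mem_fixingSubgroup_iff _ _).1 hσ x hx

theorem exists_mulEquiv [CharZero K] [DecidableEq S] [Finite S] (h0 : ∀ s, δ s ≠ 0) (hsq : ∀ s, δ s ^ 2 ∈ Z)
    (htop : IntermediateField.adjoin Z (Set.range δ) = ⊤)
    (hrZ : ∀ s, ∀ x ∈ Z, r s x = x)
    (hr : ∀ s t, r s (δ t) = if s = t then -δ t else δ t) :
    ∃ φ : Multiplicative (S → ZMod 2) ≃* Subgroup.closure (Set.range r),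
      ∀ s, (φ (Multiplicative.ofAdd (Pi.single s 1)) : K ≃ₐ[k] K) = r s := by
  choose f hf hfδ using exists_mem_closure (r := r) (δ := δ) hr
  have huniq : ∀ σ ∈ Subgroup.closure (Set.range r), ∀ τ ∈ Subgroup.closure (Set.range r),
      (∀ s, σ (δ s) = τ (δ s)) → σ = τ := fun σ hσ τ hτ h => by
    have h1 := (IntermediateField.mem_fixingSubgroup_iff _ _).1 (closure_le_fixingSubgroup hrZ hσ)
    have h2 := (IntermediateField.mem_fixingSubgroup_iff _ _).1 (closure_le_fixingSubgroup hrZ hτ)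
    exact algEquiv_ext htop (fun x hx => (h1 x hx).trans (h2 x hx).symm) h
  let g : Multiplicative (S → ZMod 2) →* Subgroup.closure (Set.range r) :=
    MonoidHom.mk' (fun ε => ⟨f ε.toAdd, hf _⟩) fun a b => by
      refine Subtype.ext (huniq _ (hf _) _ (mul_mem (hf _) (hf _)) fun s => ?_)
      change f (a.toAdd + b.toAdd) (δ s) = f a.toAdd (f b.toAdd (δ s))
      rw [hfδ, hfδ, map_mul, map_sign, hfδ, Pi.add_apply, sign_add]
      ring
  have hg : Function.Bijective g := by
    refine ⟨fun a b hab => ?_, fun σ => ?_⟩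
    · have hab : f a.toAdd = f b.toAdd := congrArg Subtype.val hab
      refine Multiplicative.toAdd.injective (funext fun s => sign_injective (K := K) ?_)
      refine mul_right_cancel₀ (h0 s) ?_
      rw [← hfδ, ← hfδ, hab]
    · obtain ⟨ε, hε⟩ := exists_sign (Z := Z) hsq (closure_le_fixingSubgroup hrZ σ.2)
      refine ⟨Multiplicative.ofAdd ε, Subtype.ext (huniq _ (hf _) _ σ.2 fun s => ?_)⟩
      rw [hε]; exact hfδ _ _
  refine ⟨MulEquiv.ofBijective g hg, fun s => ?_⟩
  refine huniq _ (hf _) _ (Subgroup.subset_closure ⟨s, rfl⟩) fun t => ?_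
  rw [hfδ, hr]
  by_cases hst : s = t
  · subst hst; simp [sign_one]
  · rw [if_neg hst, toAdd_ofAdd, Pi.single_eq_of_ne (Ne.symm hst), sign_zero, one_mul]

end KummerTwo

end

noncomputable section

/-! ### Periodic solutions of `u_t + f_t / u_{t+1} = z_t` -/

namespace MobiusRecursion

variable {k K : Type*} [Field k] [Field K] [Algebra k K] {W : IntermediateField k K}
  {f z u v : ℕ → K} {L : ℕ}

/-- The matrix `(a, b; c, d)` is the product of the one-step matrices `(0, f_t; -1, z_t)`. It is
chosen before `u`, so that two solutions can be compared through it. -/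
theorem exists_coeff (hf : ∀ t, f t ∈ W) (hz : ∀ t, z t ∈ W) (L : ℕ) :
    ∃ a ∈ W, ∃ b ∈ W, ∃ c ∈ W, ∃ d ∈ W, ∀ u : ℕ → K, (∀ t, u t ≠ 0) →
      (∀ t, u t + f t / u (t + 1) = z t) →
      a * u 0 + b = (∏ t ∈ Finset.range L, f t / u (t + 1)) * u L ∧
      c * u 0 + d = ∏ t ∈ Finset.range L, f t / u (t + 1) := by
  induction L with
  | zero =>
    exact ⟨1, one_mem _, 0, zero_mem _, 0, zero_mem _, 1, one_mem _, fun u _ _ => by simp⟩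
  | succ L ih =>
    obtain ⟨a, ha, b, hb, c, hc, d, hd, h⟩ := ih
    refine ⟨f L * c, mul_mem (hf L) hc, f L * d, mul_mem (hf L) hd,
      z L * c - a, sub_mem (mul_mem (hz L) hc) ha,
      z L * d - b, sub_mem (mul_mem (hz L) hd) hb, fun u hu hrec => ?_⟩
    obtain ⟨h1, h2⟩ := h u hu hrec
    have h3 := hrec L
    have h4 : f L / u (L + 1) * u (L + 1) = f L := div_mul_cancel₀ _ (hu _)
    rw [Finset.prod_range_succ]
    constructor
    · linear_combination f L * h2 - (∏ t ∈ Finset.range L, f t / u (t + 1)) * h4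
    · linear_combination z L * h2 - h1 - (∏ t ∈ Finset.range L, f t / u (t + 1)) * h3

variable (hf : ∀ t, f t ∈ W) (hz : ∀ t, z t ∈ W)
  (hu0 : ∀ t, u t ≠ 0) (hv0 : ∀ t, v t ≠ 0)
  (hu : ∀ t, u t + f t / u (t + 1) = z t) (hv : ∀ t, v t + f t / v (t + 1) = z t)
  (hne : ∏ t ∈ Finset.range L, f t / u (t + 1) ≠ ∏ t ∈ Finset.range L, f t / v (t + 1))

include hf hz hu0 hv0 hu hv hne

/-- The multiplier is `c u_0 + d`, to be solved for `u_0`. The second solution serves only to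
exclude `c = 0`, when both multipliers would be `d`. -/
theorem mem_of_multiplier_mem (hmem : ∏ t ∈ Finset.range L, f t / u (t + 1) ∈ W) : u 0 ∈ W := by
  obtain ⟨a, ha, b, hb, c, hc, d, hd, h⟩ := exists_coeff hf hz L
  have h1 := (h u hu0 hu).2
  have h2 := (h v hv0 hv).2
  have hc0 : c ≠ 0 := by
    rintro rfl
    exact hne (by rw [← h1, ← h2]; ring)
  have : u 0 = (∏ t ∈ Finset.range L, f t / u (t + 1) - d) / c := by
    rw [← h1]; field_simp; ring
  rw [this]
  exact div_mem (sub_mem hmem hd) hc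

/-- By periodicity the multipliers are the two eigenvalues of the matrix, with sum the trace `a +
d`. -/
theorem multiplier_add_mem (huL : u L = u 0) (hvL : v L = v 0) :
    ∏ t ∈ Finset.range L, f t / u (t + 1) + ∏ t ∈ Finset.range L, f t / v (t + 1) ∈ W := by
  obtain ⟨a, ha, b, hb, c, hc, d, hd, h⟩ := exists_coeff hf hz L
  obtain ⟨h1, h2⟩ := h u hu0 hu
  obtain ⟨h3, h4⟩ := h v hv0 hv
  rw [huL] at h1
  rw [hvL] at h3
  rw [← h2] at h1
  rw [← h4] at h3
  rw [← h2, ← h4] at hne ⊢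
  have h5 : u 0 - v 0 ≠ 0 := fun h0 => hne (by rw [sub_eq_zero.1 h0])
  have : c * u 0 + d + (c * v 0 + d) = a + d :=
    mul_left_cancel₀ h5 (by linear_combination h3 - h1)
  rw [this]
  exact add_mem ha hd

end MobiusRecursion

namespace NSLType

variable {T : NSLType} {m : ℕ} {i : T.I}

/-! ### The cosets `N_{i,s}` -/

theorem c_mul_pos (hm : 1 < m) : 0 < T.c * m := by
  refine Nat.mul_pos ?_ (by omega)
  cases T <;> simp [c]

theorem len_pos (hm : 1 < m) : 0 < T.len m i :=
  Nat.pos_of_mul_pos_right ((T.len_mul_e m i).symm ▸ c_mul_pos hm)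

theorem e_pos : 0 < T.e i := by
  cases T <;> simp only [e] <;> split_ifs <;> norm_num

theorem cast_len_mul_e : (T.len m i : T.Idx m) * (T.e i : T.Idx m) = 0 := by
  rw [← Nat.cast_mul, len_mul_e, ZMod.natCast_self]

theorem add_mem_N (hm : 1 < m) {s : T.Sig i} {n : T.Idx m} (t : ℕ) :
    n + (t : T.Idx m) * (T.e i : T.Idx m) ∈ T.N m i s ↔ n ∈ T.N m i s := by
  simp only [mem_N T m hm]
  constructor
  · rintro ⟨u, hu⟩
    exact ⟨u - t, by push_cast; linear_combination hu⟩
  · rintro ⟨u, hu⟩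
    exact ⟨u + t, by push_cast; linear_combination hu⟩

theorem add_e_mem_N (hm : 1 < m) {s : T.Sig i} {n : T.Idx m} :
    n + (T.e i : T.Idx m) ∈ T.N m i s ↔ n ∈ T.N m i s := by
  simpa using add_mem_N (n := n) (s := s) hm 1

theorem injOn_add_mul_e (n : T.Idx m) :
    Set.InjOn (fun t : ℕ => n + (t : T.Idx m) * (T.e i : T.Idx m)) (Finset.range (T.len m i)) := by
  intro t ht t' ht' h
  simp only [Finset.coe_range, Set.mem_Iio] at ht ht'
  have h1 : ((t * T.e i : ℕ) : T.Idx m) = ((t' * T.e i : ℕ) : T.Idx m) := by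
    push_cast; exact add_left_cancel h
  rw [ZMod.natCast_eq_natCast_iff, ← T.len_mul_e m i] at h1
  exact (Nat.ModEq.mul_right_cancel' e_pos.ne' h1).eq_of_lt_of_lt ht ht'

/-- A cycle may be started at any of its points: `len` steps from `n` are distinct and stay in a set
of at most `len` elements. -/
theorem N_eq_image (hm : 1 < m) {s : T.Sig i} {n : T.Idx m} (hn : n ∈ T.N m i s) :
    T.N m i s = (Finset.range (T.len m i)).image
      fun t : ℕ => n + (t : T.Idx m) * (T.e i : T.Idx m) := by
  refine (Finset.eq_of_subset_of_card_le (fun x hx => ?_) ?_).symm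
  · obtain ⟨t, -, rfl⟩ := Finset.mem_image.1 hx
    exact (add_mem_N hm t).2 hn
  · rw [Finset.card_image_of_injOn (injOn_add_mul_e n)]
    exact Finset.card_image_le

theorem prod_N_eq (hm : 1 < m) {s : T.Sig i} {n : T.Idx m} (hn : n ∈ T.N m i s)
    {M : Type*} [CommMonoid M] (f : T.Idx m → M) :
    ∏ x ∈ T.N m i s, f x =
      ∏ t ∈ Finset.range (T.len m i), f (n + (t : T.Idx m) * (T.e i : T.Idx m)) := by
  rw [N_eq_image hm hn, Finset.prod_image (injOn_add_mul_e n)]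

theorem prod_N_add_e (hm : 1 < m) (s : T.Sig i) {M : Type*} [CommMonoid M] (f : T.Idx m → M) :
    ∏ x ∈ T.N m i s, f (x + (T.e i : T.Idx m)) = ∏ x ∈ T.N m i s, f x :=
  Finset.prod_equiv (Equiv.addRight (T.e i : T.Idx m))
    (fun _ => (add_e_mem_N hm).symm) fun _ _ => rfl

theorem prod_N_sub_e (hm : 1 < m) (s : T.Sig i) {M : Type*} [CommMonoid M] (f : T.Idx m → M) :
    ∏ x ∈ T.N m i s, f (x - (T.e i : T.Idx m)) = ∏ x ∈ T.N m i s, f x := by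
  rw [← prod_N_add_e hm]
  simp only [add_sub_cancel_right]

theorem exists_mem_N (hm : 1 < m) (n : T.Idx m) : ∃ s : T.Sig i, n ∈ T.N m i s := by
  have : NeZero (T.c * m) := ⟨(c_mul_pos hm).ne'⟩
  refine ⟨⟨n.val % T.e i, Nat.mod_lt _ e_pos⟩, (mem_N T m hm i _ n).2
    ⟨((n.val / T.e i : ℕ) : ℤ), ?_⟩⟩
  conv_lhs => rw [← ZMod.natCast_zmod_val n, ← Nat.div_add_mod' n.val (T.e i)]
  rw [Int.cast_natCast, Nat.cast_add, Nat.cast_mul]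

theorem eq_of_mem_N (hm : 1 < m) {s s' : T.Sig i} {n : T.Idx m} (h : n ∈ T.N m i s)
    (h' : n ∈ T.N m i s') : s = s' := by
  have : NeZero (T.c * m) := ⟨(c_mul_pos hm).ne'⟩
  simp only [N, Finset.mem_image, Finset.mem_range] at h h'
  obtain ⟨t, -, rfl⟩ := h
  obtain ⟨t', -, h⟩ := h'
  have h1 : ((t' * T.e i + s'.val : ℕ) : T.Idx m) = ((t * T.e i + s.val : ℕ) : T.Idx m) := by
    push_cast; exact h
  rw [ZMod.natCast_eq_natCast_iff] at h1
  have h2 : t' * T.e i + s'.val ≡ t * T.e i + s.val [MOD T.e i] :=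
    h1.of_dvd ((T.e_dvd_c i).mul_right m)
  have h3 : ∀ (t : ℕ) (s : T.Sig i), (t * T.e i + s.val) % T.e i = s.val := fun t s => by
    rw [Nat.mul_add_mod_self_right, Nat.mod_eq_of_lt s.2]
  rw [Nat.ModEq, h3, h3] at h2
  exact Fin.ext h2.symm

theorem N_nonempty (hm : 1 < m) (s : T.Sig i) : (T.N m i s).Nonempty :=
  ⟨_, Finset.mem_image.2 ⟨0, Finset.mem_range.2 (len_pos hm), rfl⟩⟩

theorem card_N_pos (hm : 1 < m) (s : T.Sig i) : 0 < (T.N m i s).card :=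
  (N_nonempty hm s).card_pos

/-! ### The elements `F_i(n)` -/

/-- The multiplicative monoid generated by the `y_j(n)` with `j ≠ i`. -/
def otherY (T : NSLType) (m : ℕ) (i : T.I) : Submonoid (T.Y m) :=
  Submonoid.closure {w | ∃ j n, j ≠ i ∧ w = T.y m j n}

theorem y_mem_otherY {j : T.I} (h : j ≠ i) (n : T.Idx m) : T.y m j n ∈ T.otherY m i :=
  Submonoid.subset_closure ⟨j, n, h, rfl⟩

theorem yl_mem_otherY {a : ℕ} (h : a ≠ T.label i) (n : T.Idx m) : T.yl m a n ∈ T.otherY m i := by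
  unfold yl
  split_ifs with ha
  · refine y_mem_otherY (fun hi => h ?_) n
    rw [← hi, label]
    exact (Nat.sub_add_cancel ha.1).symm
  · exact one_mem _

theorem Fgen_mem_otherY (n : T.Idx m) : T.Fgen m i n ∈ T.otherY m i := by
  refine mul_mem (prod_mem fun j hj => ?_) (prod_mem fun j hj => ?_)
  · exact y_mem_otherY (Finset.mem_filter.1 hj).2.1.ne _
  · exact y_mem_otherY (Finset.mem_filter.1 hj).2.1.ne' _

/-- The explicit shape of `F` in each Dynkin type is used only here: it is a monomial without `y_i`.
-/
theorem F_mem_otherY (n : T.Idx m) : T.F m i n ∈ T.otherY m i := by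
  cases T <;> simp only [F] <;> split_ifs <;>
    first
    | exact Fgen_mem_otherY n
    | (repeat' apply mul_mem) <;> apply yl_mem_otherY <;> simp only [label] at * <;> omega

theorem y_ne_zero (j : T.I) (n : T.Idx m) : T.y m j n ≠ 0 :=
  (map_ne_zero_iff _ (IsFractionRing.injective _ _)).2 (MvPolynomial.X_ne_zero _)

theorem F_mem {W : IntermediateField ℂ (T.Y m)} (hW : ∀ j n, j ≠ i → T.y m j n ∈ W)
    (n : T.Idx m) : T.F m i n ∈ W := by
  have h : T.otherY m i ≤ W.toSubalgebra.toSubmonoid := by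
    refine Submonoid.closure_le.2 ?_
    rintro _ ⟨j, n, hj, rfl⟩
    exact hW j n hj
  exact h (F_mem_otherY n)

theorem map_F {ρ : T.Y m ≃ₐ[ℂ] T.Y m} (hρ : ∀ j n, j ≠ i → ρ (T.y m j n) = T.y m j n)
    (n : T.Idx m) : ρ (T.F m i n) = T.F m i n := by
  have h : T.otherY m i ≤ MonoidHom.eqLocusM (ρ : T.Y m →* T.Y m) (MonoidHom.id _) := by
    refine Submonoid.closure_le.2 ?_
    rintro _ ⟨j, n, hj, rfl⟩
    exact hρ j n hj
  exact h (F_mem_otherY n)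

/-! ### Values of rational functions at a point -/

/-- The rational function `w` is regular at the point `y_i(n) = 2`, `y_j(n) = 1` (`j ≠ i`),
with value `a` there. -/
def HasValue (i : T.I) (w : T.Y m) (a : ℝ) : Prop :=
  ∃ p q : MvPolynomial (T.I × T.Idx m) ℂ,
    MvPolynomial.eval (fun x => if x.1 = i then 2 else 1) q ≠ 0 ∧
    w * algebraMap _ (T.Y m) q = algebraMap _ (T.Y m) p ∧
    MvPolynomial.eval (fun x => if x.1 = i then 2 else 1) p =
      a * MvPolynomial.eval (fun x => if x.1 = i then 2 else 1) q

namespace HasValue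

variable {w w' : T.Y m} {a b : ℝ}

theorem ne_zero (h : HasValue i w a) (ha : a ≠ 0) : w ≠ 0 := by
  rintro rfl
  obtain ⟨p, q, hq, h, hp⟩ := h
  rw [zero_mul, eq_comm, map_eq_zero_iff _ (IsFractionRing.injective _ _)] at h
  rw [h, map_zero, eq_comm] at hp
  exact mul_ne_zero (Complex.ofReal_ne_zero.2 ha) hq hp

theorem one : HasValue i (1 : T.Y m) 1 := ⟨1, 1, by simp⟩

theorem zero : HasValue i (0 : T.Y m) 0 := ⟨0, 1, by simp⟩

theorem add (h : HasValue i w a) (h' : HasValue i w' b) : HasValue i (w + w') (a + b) := by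
  obtain ⟨p, q, hq, h, hp⟩ := h
  obtain ⟨p', q', hq', h', hp'⟩ := h'
  refine ⟨p * q' + p' * q, q * q', ?_, ?_, ?_⟩
  · rw [map_mul]; exact mul_ne_zero hq hq'
  · simp only [map_add, map_mul, ← h, ← h']; ring
  · simp only [map_add, map_mul, hp, hp']; push_cast; ring

theorem mul (h : HasValue i w a) (h' : HasValue i w' b) : HasValue i (w * w') (a * b) := by
  obtain ⟨p, q, hq, h, hp⟩ := h
  obtain ⟨p', q', hq', h', hp'⟩ := h'
  refine ⟨p * p', q * q', ?_, ?_, ?_⟩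
  · rw [map_mul]; exact mul_ne_zero hq hq'
  · simp only [map_mul, ← h, ← h']; ring
  · simp only [map_mul, hp, hp']; push_cast; ring

theorem neg (h : HasValue i w a) : HasValue i (-w) (-a) := by
  obtain ⟨p, q, hq, h, hp⟩ := h
  exact ⟨-p, q, hq, by rw [map_neg, ← h, neg_mul], by rw [map_neg, hp]; push_cast; ring⟩

theorem sub (h : HasValue i w a) (h' : HasValue i w' b) : HasValue i (w - w') (a - b) := by
  rw [sub_eq_add_neg, sub_eq_add_neg]
  exact h.add h'.neg

theorem inv (h : HasValue i w a) (ha : a ≠ 0) : HasValue i w⁻¹ a⁻¹ := by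
  have hw := h.ne_zero ha
  obtain ⟨p, q, hq, h, hp⟩ := h
  have ha' := Complex.ofReal_ne_zero.2 ha
  refine ⟨q, p, ?_, ?_, ?_⟩
  · rw [hp]; exact mul_ne_zero ha' hq
  · rw [← h, inv_mul_cancel_left₀ hw]
  · rw [hp, Complex.ofReal_inv, inv_mul_cancel_left₀ ha']

theorem div (h : HasValue i w a) (h' : HasValue i w' b) (hb : b ≠ 0) :
    HasValue i (w / w') (a / b) := by
  rw [div_eq_mul_inv, div_eq_mul_inv]
  exact h.mul (h'.inv hb)

theorem prod {ι : Type*} (s : Finset ι) {f : ι → T.Y m} {g : ι → ℝ}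
    (h : ∀ x, HasValue i (f x) (g x)) : HasValue i (∏ x ∈ s, f x) (∏ x ∈ s, g x) := by
  classical
  induction s using Finset.induction_on with
  | empty => exact one
  | insert x s hx ih => rw [Finset.prod_insert hx, Finset.prod_insert hx]; exact (h x).mul ih

theorem sum {ι : Type*} (s : Finset ι) {f : ι → T.Y m} {g : ι → ℝ}
    (h : ∀ x, HasValue i (f x) (g x)) : HasValue i (∑ x ∈ s, f x) (∑ x ∈ s, g x) := by
  classical
  induction s using Finset.induction_on with
  | empty => exact zero
  | insert x s hx ih => rw [Finset.sum_insert hx, Finset.sum_insert hx]; exact (h x).add ih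

end HasValue

theorem hasValue_y_self (n : T.Idx m) : HasValue i (T.y m i n) 2 :=
  ⟨MvPolynomial.X (i, n), 1, by simp [y]⟩

theorem hasValue_F (n : T.Idx m) : HasValue i (T.F m i n) 1 := by
  refine Submonoid.closure_induction (motive := fun w _ => HasValue i w 1) ?_ HasValue.one ?_
    (F_mem_otherY n)
  · rintro _ ⟨j, n, hj, rfl⟩
    exact ⟨MvPolynomial.X (j, n), 1, by simp [y, hj]⟩
  · intro x y _ _ hx hy
    simpa using hx.mul hy

theorem F_ne_zero (n : T.Idx m) : T.F m i n ≠ 0 := (hasValue_F n).ne_zero one_ne_zero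

theorem X_ne_zero (n : T.Idx m) : T.X m i n ≠ 0 :=
  div_ne_zero (F_ne_zero n) (mul_ne_zero (y_ne_zero _ _) (y_ne_zero _ _))

/-- At the chosen point every `X_i` takes the value `1/4`, so `P_i` takes a positive one; values are
kept real to allow this positivity argument. -/
theorem P_ne_zero (n : T.Idx m) : T.P m i n ≠ 0 := by
  have hX : ∀ n, HasValue i (T.X m i n) (1 / (2 * 2)) := fun n =>
    (hasValue_F n).div ((hasValue_y_self _).mul (hasValue_y_self _)) (by norm_num)
  have h := HasValue.one.add (HasValue.sum (Finset.range (T.len m i - 1)) fun k =>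
    HasValue.prod (Finset.range (k + 1)) fun p =>
      hX (n - (p : T.Idx m) * (T.e i : T.Idx m)))
  exact h.ne_zero (by positivity)

theorem bigY_ne_zero (s : T.Sig i) : T.bigY m i s ≠ 0 :=
  Finset.prod_ne_zero_iff.2 fun _ _ => y_ne_zero _ _

theorem bigF_ne_zero (s : T.Sig i) : T.bigF m i s ≠ 0 :=
  Finset.prod_ne_zero_iff.2 fun _ _ => F_ne_zero _

/-- The value is `2^N - 2^(-N)` with `N ≥ 1` the size of the coset. Setting all variables to `1`
would give `0`, hence the choice `y_i = 2`. -/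
theorem delta_ne_zero (hm : 1 < m) (s : T.Sig i) : T.delta m i s ≠ 0 := by
  have hY : HasValue i (T.bigY m i s) (∏ n ∈ T.N m i s, 2) :=
    HasValue.prod _ fun n => hasValue_y_self n
  have hF : HasValue i (T.bigF m i s) (∏ n ∈ T.N m i s, 1) :=
    HasValue.prod _ fun n => hasValue_F n
  refine (hY.sub (hF.div hY (by simp))).ne_zero ?_
  rw [Finset.prod_const, Finset.prod_const_one]
  have h : (1 : ℝ) < 2 ^ (T.N m i s).card := one_lt_pow₀ one_lt_two (card_N_pos hm s).ne'
  have h' : 1 / (2 : ℝ) ^ (T.N m i s).card < 1 := (div_lt_one (by positivity)).2 h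
  exact (sub_pos.2 (h'.trans h)).ne'

/-! ### The reflected variables -/

/-- The image of `y_i(n)` under the reflection that moves it. -/
def reflY (T : NSLType) (m : ℕ) (i : T.I) (n : T.Idx m) : T.Y m :=
  T.P m i (n - 2 * (T.e i : T.Idx m)) / T.P m i (n - (T.e i : T.Idx m)) * T.y m i n *
    T.X m i (n - (T.e i : T.Idx m))

theorem reflY_ne_zero (n : T.Idx m) : T.reflY m i n ≠ 0 :=
  mul_ne_zero (mul_ne_zero (div_ne_zero (P_ne_zero _) (P_ne_zero _)) (y_ne_zero _ _))
    (X_ne_zero _)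

theorem P_eq_sum (hm : 1 < m) (n : T.Idx m) :
    T.P m i n = ∑ k ∈ Finset.range (T.len m i), ∏ p ∈ Finset.range k,
      T.X m i (n - (p : T.Idx m) * (T.e i : T.Idx m)) := by
  obtain ⟨L, hL⟩ := Nat.exists_eq_succ_of_ne_zero (len_pos (i := i) hm).ne'
  rw [P, hL, Finset.sum_range_succ', Finset.prod_range_zero, add_comm]
  rfl

theorem prod_X_succ (n : T.Idx m) (k : ℕ) :
    ∏ p ∈ Finset.range (k + 1), T.X m i (n - (p : T.Idx m) * (T.e i : T.Idx m)) =
      T.X m i n * ∏ p ∈ Finset.range k,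
        T.X m i (n - (T.e i : T.Idx m) - (p : T.Idx m) * (T.e i : T.Idx m)) := by
  rw [Finset.prod_range_succ', mul_comm]
  congr 1
  · simp
  · refine Finset.prod_congr rfl fun p _ => ?_
    congr 1
    push_cast
    ring

/-- `P` sums the products of lengths `0` to `len - 1`. With the full-cycle product added, every
nonempty product has the factor `X n` to split off. -/
theorem P_add_prod (hm : 1 < m) (n : T.Idx m) :
    T.P m i n + ∏ p ∈ Finset.range (T.len m i),
        T.X m i (n - (p : T.Idx m) * (T.e i : T.Idx m)) =
      1 + T.X m i n * T.P m i (n - (T.e i : T.Idx m)) := by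
  rw [P_eq_sum hm, ← Finset.sum_range_succ, Finset.sum_range_succ', Finset.prod_range_zero,
    add_comm, P_eq_sum hm, Finset.mul_sum]
  simp only [prod_X_succ]

theorem prod_X_sub_e (n : T.Idx m) :
    ∏ p ∈ Finset.range (T.len m i),
        T.X m i (n - (T.e i : T.Idx m) - (p : T.Idx m) * (T.e i : T.Idx m)) =
      ∏ p ∈ Finset.range (T.len m i), T.X m i (n - (p : T.Idx m) * (T.e i : T.Idx m)) := by
  refine mul_left_cancel₀ (X_ne_zero (i := i) n) ?_
  rw [← prod_X_succ, Finset.prod_range_succ, cast_len_mul_e, sub_zero, mul_comm]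

/-- The full-cycle product is invariant under the shift by `d_i`, so it cancels between `P_add_prod`
at `n` and at `n - d_i`. The result is the invariance of `z_i` with denominators cleared. -/
theorem P_mul_one_add_X (hm : 1 < m) (n : T.Idx m) :
    T.P m i (n - (T.e i : T.Idx m)) * (1 + T.X m i n) =
      T.P m i n + T.X m i (n - (T.e i : T.Idx m)) * T.P m i (n - 2 * (T.e i : T.Idx m)) := by
  have h1 := P_add_prod (i := i) hm n
  have h2 := P_add_prod (i := i) hm (n - (T.e i : T.Idx m))
  rw [prod_X_sub_e] at h2
  have h3 : n - (T.e i : T.Idx m) - (T.e i : T.Idx m) = n - 2 * (T.e i : T.Idx m) := by ring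
  rw [h3] at h2
  linear_combination h2 - h1

theorem reflY_add_div (hm : 1 < m) (n : T.Idx m) :
    T.reflY m i n + T.F m i n / T.reflY m i (n + (T.e i : T.Idx m)) = T.z m i n := by
  have h := P_mul_one_add_X (i := i) hm n
  have h1 : n + (T.e i : T.Idx m) - (T.e i : T.Idx m) = n := by ring
  have h2 : n + (T.e i : T.Idx m) - 2 * (T.e i : T.Idx m) = n - (T.e i : T.Idx m) := by ring
  have hP := P_ne_zero (i := i) n
  have hP1 := P_ne_zero (i := i) (n - (T.e i : T.Idx m))
  have hy := y_ne_zero i n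
  have hy1 := y_ne_zero i (n + (T.e i : T.Idx m))
  have hF := F_ne_zero (i := i) n
  have hX : T.X m i n = T.F m i n / (T.y m i n * T.y m i (n + (T.e i : T.Idx m))) := rfl
  have h3 : T.F m i n / T.reflY m i (n + (T.e i : T.Idx m)) =
      T.y m i n * T.P m i n / T.P m i (n - (T.e i : T.Idx m)) := by
    rw [reflY, h1, h2, hX]
    field_simp
  have h4 : T.z m i n = T.y m i n * (1 + T.X m i n) := by
    rw [z, hX]
    field_simp
  rw [h3, h4, reflY]
  field_simp
  linear_combination -h

/-- The quotients of consecutive `P`'s cancel around the cycle. -/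
theorem prod_reflY (hm : 1 < m) (s : T.Sig i) :
    ∏ n ∈ T.N m i s, T.reflY m i n = T.bigF m i s / T.bigY m i s := by
  have hP : ∏ n ∈ T.N m i s, T.P m i (n - 2 * (T.e i : T.Idx m)) =
      ∏ n ∈ T.N m i s, T.P m i (n - (T.e i : T.Idx m)) := by
    rw [← prod_N_sub_e hm s fun n => T.P m i (n - (T.e i : T.Idx m))]
    refine Finset.prod_congr rfl fun n _ => ?_
    congr 1
    ring
  have hX : ∏ n ∈ T.N m i s, T.X m i (n - (T.e i : T.Idx m)) =
      T.bigF m i s / (T.bigY m i s * T.bigY m i s) := by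
    rw [prod_N_sub_e hm s (T.X m i)]
    simp only [X, Finset.prod_div_distrib, Finset.prod_mul_distrib]
    rw [prod_N_add_e hm s (T.y m i)]
    rfl
  have hP0 : ∏ n ∈ T.N m i s, T.P m i (n - (T.e i : T.Idx m)) ≠ 0 :=
    Finset.prod_ne_zero_iff.2 fun _ _ => P_ne_zero _
  simp only [reflY, Finset.prod_mul_distrib, Finset.prod_div_distrib]
  rw [hP, div_self hP0, one_mul, hX]
  change T.bigY m i s * _ = _
  have := bigY_ne_zero (m := m) s
  field_simp

end NSLType

end

noncomputable section

/-! ### Generalities on generated subfields -/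

namespace IntermediateField

variable {k K : Type*} [Field k] [Field K] [Algebra k K]

theorem algEquiv_eqOn_adjoin {S : Set K} {σ τ : K ≃ₐ[k] K} (h : ∀ x ∈ S, σ x = τ x) :
    ∀ x ∈ adjoin k S, σ x = τ x := fun x hx => by
  induction hx using adjoin_induction with
  | mem x hx => exact h x hx
  | algebraMap x => rw [AlgEquiv.commutes, AlgEquiv.commutes]
  | add x y _ _ hx hy => rw [map_add, map_add, hx, hy]
  | inv x _ hx => rw [map_inv₀, map_inv₀, hx]
  | mul x y _ _ hx hy => rw [map_mul, map_mul, hx, hy]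

/-- Moves a generation statement over `Z` to intermediate fields over `k`, where the recursion
lemmas are stated. -/
theorem adjoin_eq_top_of_forall {Z : IntermediateField k K} {S : Set K}
    (h : ∀ W : IntermediateField k K, Z ≤ W → S ⊆ W → W = ⊤) : adjoin Z S = ⊤ := by
  rw [← restrictScalars_eq_top_iff (K := k)]
  exact h _ (fun x hx => (adjoin Z S).algebraMap_mem ⟨x, hx⟩) (subset_adjoin Z S)

end IntermediateField

namespace NSLType

variable {T : NSLType} {m : ℕ} {i : T.I}

/-! ### Generation of intermediate fields -/

theorem eq_top_of_y_mem {W : IntermediateField ℂ (T.Y m)} (h : ∀ j n, T.y m j n ∈ W) : W = ⊤ := by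
  have hpoly : ∀ p : MvPolynomial (T.I × T.Idx m) ℂ, algebraMap _ (T.Y m) p ∈ W := fun p => by
    induction p using MvPolynomial.induction_on with
    | C a => exact W.algebraMap_mem a
    | add p q hp hq => rw [map_add]; exact add_mem hp hq
    | mul_X p x hp => rw [map_mul]; exact mul_mem hp (h x.1 x.2)
  refine eq_top_iff.2 fun w _ => ?_
  obtain ⟨p, q, -, rfl⟩ := IsFractionRing.div_surjective (A := MvPolynomial (T.I × T.Idx m) ℂ) w
  exact div_mem (hpoly p) (hpoly q)

section Cycle

variable {W : IntermediateField ℂ (T.Y m)} (hm : 1 < m) (hz : ∀ n, T.z m i n ∈ W)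
  (hy : ∀ j n, j ≠ i → T.y m j n ∈ W) (s : T.Sig i)

theorem prod_range_F_div {s : T.Sig i} {n : T.Idx m} (hm : 1 < m) (hn : n ∈ T.N m i s)
    (u : T.Idx m → T.Y m) :
    ∏ t ∈ Finset.range (T.len m i), T.F m i (n + (t : T.Idx m) * (T.e i : T.Idx m)) /
        u (n + ((t + 1 : ℕ) : T.Idx m) * (T.e i : T.Idx m)) =
      T.bigF m i s / ∏ x ∈ T.N m i s, u x := by
  rw [Finset.prod_div_distrib, ← prod_N_eq hm hn (T.F m i), ← prod_N_add_e hm s u,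
    prod_N_eq hm hn fun x => u (x + (T.e i : T.Idx m))]
  congr 1
  refine Finset.prod_congr rfl fun t _ => ?_
  congr 1
  push_cast
  ring

theorem add_cast_succ_mul (n : T.Idx m) (t : ℕ) :
    n + ((t + 1 : ℕ) : T.Idx m) * (T.e i : T.Idx m) =
      n + (t : T.Idx m) * (T.e i : T.Idx m) + (T.e i : T.Idx m) := by
  push_cast
  ring

theorem bigF_div_prod_reflY (hm : 1 < m) (s : T.Sig i) :
    T.bigF m i s / ∏ x ∈ T.N m i s, T.reflY m i x = T.bigY m i s := by
  rw [prod_reflY hm, div_div_cancel₀ (bigF_ne_zero s)]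

include hm hz hy in
theorem y_mem_of_bigF_div_bigY_mem {n : T.Idx m} (hn : n ∈ T.N m i s)
    (h : T.bigF m i s / T.bigY m i s ∈ W) : T.y m i n ∈ W := by
  have key := MobiusRecursion.mem_of_multiplier_mem (W := W) (L := T.len m i)
    (f := fun t => T.F m i (n + (t : T.Idx m) * (T.e i : T.Idx m)))
    (z := fun t => T.z m i (n + (t : T.Idx m) * (T.e i : T.Idx m)))
    (u := fun t => T.y m i (n + (t : T.Idx m) * (T.e i : T.Idx m)))
    (v := fun t => T.reflY m i (n + (t : T.Idx m) * (T.e i : T.Idx m)))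
    (fun t => F_mem hy _) (fun t => hz _) (fun t => y_ne_zero _ _) (fun t => reflY_ne_zero _)
    (fun t => by simp only [add_cast_succ_mul]; rfl)
    (fun t => by simp only [add_cast_succ_mul]; exact reflY_add_div hm _) ?_ ?_
  · simpa using key
  · rw [prod_range_F_div hm hn, prod_range_F_div hm hn, bigF_div_prod_reflY hm]
    exact fun h => delta_ne_zero hm s (sub_eq_zero.2 h.symm)
  · rw [prod_range_F_div hm hn]
    exact h

include hm hz hy in
theorem bigF_div_bigY_add_bigY_mem : T.bigF m i s / T.bigY m i s + T.bigY m i s ∈ W := by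
  obtain ⟨n, hn⟩ := N_nonempty (m := m) hm s
  have hne : T.bigF m i s / T.bigY m i s ≠ T.bigY m i s :=
    fun h => delta_ne_zero hm s (sub_eq_zero.2 h.symm)
  have key := MobiusRecursion.multiplier_add_mem (W := W) (L := T.len m i)
    (f := fun t => T.F m i (n + (t : T.Idx m) * (T.e i : T.Idx m)))
    (z := fun t => T.z m i (n + (t : T.Idx m) * (T.e i : T.Idx m)))
    (u := fun t => T.y m i (n + (t : T.Idx m) * (T.e i : T.Idx m)))
    (v := fun t => T.reflY m i (n + (t : T.Idx m) * (T.e i : T.Idx m)))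
    (fun t => F_mem hy _) (fun t => hz _) (fun t => y_ne_zero _ _) (fun t => reflY_ne_zero _)
    (fun t => by simp only [add_cast_succ_mul]; rfl)
    (fun t => by simp only [add_cast_succ_mul]; exact reflY_add_div hm _) ?_ ?_ ?_
  · rw [prod_range_F_div hm hn, prod_range_F_div hm hn, bigF_div_prod_reflY hm] at key
    exact key
  · rw [prod_range_F_div hm hn, prod_range_F_div hm hn, bigF_div_prod_reflY hm]
    exact hne
  · simp [cast_len_mul_e]
  · simp [cast_len_mul_e]

include hm hz hy in
-- Stated for arbitrary `W` because it serves twice: for fields containing `Z` and the `δ`'s, and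
-- for the field generated by the reflected variables.
theorem eq_top_of_bigF_div_bigY_mem (h : ∀ s, T.bigF m i s / T.bigY m i s ∈ W) : W = ⊤ := by
  refine eq_top_of_y_mem fun j n => ?_
  by_cases hj : j = i
  · subst hj
    obtain ⟨s, hs⟩ := exists_mem_N (i := j) hm n
    exact y_mem_of_bigF_div_bigY_mem hm hz hy s hs (h s)
  · exact hy j n hj

end Cycle

/-! ### The square roots `δ_{i,s}` over `𝒵_m^{(i)}` -/

theorem z_mem_Z (n : T.Idx m) : T.z m i n ∈ T.Z m i :=
  IntermediateField.subset_adjoin _ _ (Or.inl ⟨n, rfl⟩)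

theorem y_mem_Z (j : T.I) (n : T.Idx m) (h : j ≠ i) : T.y m j n ∈ T.Z m i :=
  IntermediateField.subset_adjoin _ _ (Or.inr ⟨j, n, h, rfl⟩)

theorem delta_sq_mem_Z (hm : 1 < m) (s : T.Sig i) : T.delta m i s ^ 2 ∈ T.Z m i := by
  -- The discriminant: trace squared minus four times the determinant.
  have h : T.delta m i s ^ 2 =
      (T.bigF m i s / T.bigY m i s + T.bigY m i s) ^ 2 - 4 * T.bigF m i s := by
    have := bigY_ne_zero (m := m) s
    rw [delta]
    field_simp
    ring
  rw [h]
  refine sub_mem (pow_mem (bigF_div_bigY_add_bigY_mem hm z_mem_Z y_mem_Z s) 2)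
    (mul_mem (ofNat_mem _ 4) (prod_mem fun n _ => F_mem y_mem_Z n))

theorem adjoin_delta_eq_top (hm : 1 < m) :
    IntermediateField.adjoin (T.Z m i) (Set.range (T.delta m i)) = ⊤ := by
  refine IntermediateField.adjoin_eq_top_of_forall fun W hZ hδ => ?_
  refine eq_top_of_bigF_div_bigY_mem hm (fun n => hZ (z_mem_Z n))
    (fun j n hj => hZ (y_mem_Z j n hj)) fun s => ?_
  have h : T.bigF m i s / T.bigY m i s =
      (T.bigF m i s / T.bigY m i s + T.bigY m i s - T.delta m i s) / 2 := by
    rw [delta]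
    ring
  rw [h]
  exact div_mem (sub_mem (hZ (bigF_div_bigY_add_bigY_mem hm z_mem_Z y_mem_Z s))
    (hδ ⟨s, rfl⟩)) (ofNat_mem _ 2)

/-! ### The reflections -/

/-- The prescribed values of `r_{i,s}` on the variables. -/
def reflVar (T : NSLType) (m : ℕ) (i : T.I) (s : T.Sig i) (x : T.I × T.Idx m) : T.Y m :=
  if x.1 = i ∧ x.2 ∈ T.N m i s then T.reflY m i x.2 else T.y m x.1 x.2

theorem reflVar_of_mem {s : T.Sig i} {n : T.Idx m} (h : n ∈ T.N m i s) :
    T.reflVar m i s (i, n) = T.reflY m i n := if_pos ⟨rfl, h⟩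

theorem reflVar_of_notMem {s : T.Sig i} {n : T.Idx m} (h : n ∉ T.N m i s) :
    T.reflVar m i s (i, n) = T.y m i n := if_neg fun h' => h h'.2

theorem reflVar_of_ne (s : T.Sig i) {j : T.I} (n : T.Idx m) (h : j ≠ i) :
    T.reflVar m i s (j, n) = T.y m j n := if_neg fun h' => h h'.1

theorem reflVar_add_div (hm : 1 < m) (s : T.Sig i) (n : T.Idx m) :
    T.reflVar m i s (i, n) + T.F m i n / T.reflVar m i s (i, n + (T.e i : T.Idx m)) =
      T.z m i n := by
  by_cases h : n ∈ T.N m i s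
  · rw [reflVar_of_mem h, reflVar_of_mem ((add_e_mem_N hm).2 h), reflY_add_div hm]
  · rw [reflVar_of_notMem h, reflVar_of_notMem (mt (add_e_mem_N hm).1 h), z]

theorem prod_reflVar (hm : 1 < m) (s t : T.Sig i) :
    ∏ n ∈ T.N m i t, T.reflVar m i s (i, n) =
      if s = t then T.bigF m i t / T.bigY m i t else T.bigY m i t := by
  split_ifs with h
  · subst h
    rw [← prod_reflY hm]
    exact Finset.prod_congr rfl fun n hn => reflVar_of_mem hn
  · exact Finset.prod_congr rfl fun n hn =>
      reflVar_of_notMem fun hn' => h (eq_of_mem_N hm hn' hn)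

/-- The reflected variables recover `z_i` by the recursion, and their product over a coset is `F/y`
or `y`, either of which yields `F/y`. -/
theorem adjoin_reflVar_eq_top (hm : 1 < m) (s : T.Sig i) :
    IntermediateField.adjoin ℂ (Set.range (T.reflVar m i s)) = ⊤ := by
  have hmem : ∀ x, T.reflVar m i s x ∈
      IntermediateField.adjoin ℂ (Set.range (T.reflVar m i s)) :=
    fun x => IntermediateField.subset_adjoin _ _ ⟨x, rfl⟩
  have hy : ∀ j n, j ≠ i → T.y m j n ∈
      IntermediateField.adjoin ℂ (Set.range (T.reflVar m i s)) := fun j n hj => by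
    rw [← reflVar_of_ne s n hj]
    exact hmem _
  refine eq_top_of_bigF_div_bigY_mem hm (fun n => ?_) hy fun t => ?_
  · rw [← reflVar_add_div hm s]
    exact add_mem (hmem _) (div_mem (F_mem hy n) (hmem _))
  · have h := prod_mem (t := T.N m i t) fun n (_ : n ∈ T.N m i t) => hmem (i, n)
    rw [prod_reflVar hm] at h
    split_ifs at h
    · exact h
    · exact div_mem (prod_mem fun n _ => F_mem hy n) h

theorem finite_vars (hm : 1 < m) : Finite (T.I × T.Idx m) := by
  have : NeZero (T.c * m) := ⟨(c_mul_pos hm).ne'⟩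
  infer_instance

theorem algebraicIndependent_y :
    AlgebraicIndependent ℂ fun x : T.I × T.Idx m => T.y m x.1 x.2 := by
  have h : MvPolynomial.aeval (fun x : T.I × T.Idx m => T.y m x.1 x.2) =
      IsScalarTower.toAlgHom ℂ (MvPolynomial (T.I × T.Idx m) ℂ) (T.Y m) :=
    MvPolynomial.algHom_ext fun x => MvPolynomial.aeval_X _ _
  rw [AlgebraicIndependent, h]
  exact IsFractionRing.injective _ _

theorem algebraicIndependent_reflVar (hm : 1 < m) (s : T.Sig i) :
    AlgebraicIndependent ℂ (T.reflVar m i s) := by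
  have := finite_vars (T := T) hm
  have halg : Algebra.IsAlgebraic (Algebra.adjoin ℂ (Set.range (T.reflVar m i s))) (T.Y m) := by
    refine ⟨fun w => ?_⟩
    have hw : w ∈ IntermediateField.adjoin ℂ (Set.range (T.reflVar m i s)) :=
      adjoin_reflVar_eq_top hm s ▸ IntermediateField.mem_top
    obtain ⟨r, hr, q, hq, rfl⟩ := IntermediateField.mem_adjoin_iff_div.1 hw
    rw [div_eq_mul_inv]
    exact (isAlgebraic_algebraMap
      (⟨r, hr⟩ : Algebra.adjoin ℂ (Set.range (T.reflVar m i s)))).mul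
      (isAlgebraic_algebraMap
      (⟨q, hq⟩ : Algebra.adjoin ℂ (Set.range (T.reflVar m i s)))).inv
  -- The family is finite, indexed like the `y_j(n)`, and `𝒴_m` is algebraic over it, so it is a
  -- transcendence basis by counting.
  exact (Algebra.IsAlgebraic.isTranscendenceBasis_of_le_trdeg_of_finite ℂ (T.reflVar m i s)
    (algebraicIndependent_y (T := T) (m := m)).cardinalMk_le_trdeg).1

theorem exists_isReflection (hm : 1 < m) (s : T.Sig i) :
    ∃ ρ : T.Y m ≃ₐ[ℂ] T.Y m, T.IsReflection m i s ρ := by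
  have hinj : Function.Injective (MvPolynomial.aeval (R := ℂ) (T.reflVar m i s)) :=
    algebraicIndependent_reflVar hm s
  let φ : T.Y m →ₐ[ℂ] T.Y m := IsFractionRing.liftAlgHom hinj
  have hφ : ∀ x : T.I × T.Idx m, φ (T.y m x.1 x.2) = T.reflVar m i s x := fun x => by
    change IsFractionRing.lift hinj (algebraMap _ _ (MvPolynomial.X x)) = _
    rw [IsFractionRing.lift_algebraMap]
    exact MvPolynomial.aeval_X _ _
  have hsurj : Function.Surjective φ := by
    rw [← AlgHom.fieldRange_eq_top, eq_top_iff, ← adjoin_reflVar_eq_top hm s,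
      IntermediateField.adjoin_le_iff]
    rintro _ ⟨x, rfl⟩
    exact ⟨_, hφ x⟩
  exact ⟨AlgEquiv.ofBijective φ ⟨φ.injective, hsurj⟩, fun j n => hφ (j, n)⟩

theorem algEquiv_ext_y {ρ σ : T.Y m ≃ₐ[ℂ] T.Y m} (h : ∀ j n, ρ (T.y m j n) = σ (T.y m j n)) :
    ρ = σ := by
  have htop : IntermediateField.adjoin ℂ (Set.range fun x : T.I × T.Idx m => T.y m x.1 x.2) = ⊤ :=
    eq_top_of_y_mem fun j n => IntermediateField.subset_adjoin _ _ ⟨(j, n), rfl⟩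
  refine AlgEquiv.ext fun w => IntermediateField.algEquiv_eqOn_adjoin ?_ w
    (htop ▸ IntermediateField.mem_top)
  rintro _ ⟨x, rfl⟩
  exact h x.1 x.2

namespace IsReflection

variable {s : T.Sig i} {ρ : T.Y m ≃ₐ[ℂ] T.Y m} (hρ : T.IsReflection m i s ρ)

include hρ

theorem apply_y (j : T.I) (n : T.Idx m) : ρ (T.y m j n) = T.reflVar m i s (j, n) := hρ j n

theorem apply_y_of_ne (j : T.I) (n : T.Idx m) (hj : j ≠ i) : ρ (T.y m j n) = T.y m j n := by
  rw [hρ.apply_y, reflVar_of_ne s n hj]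

theorem apply_z (hm : 1 < m) (n : T.Idx m) : ρ (T.z m i n) = T.z m i n := by
  conv_lhs => rw [z]
  rw [map_add, map_div₀, map_F hρ.apply_y_of_ne, hρ.apply_y, hρ.apply_y, reflVar_add_div hm]

theorem apply_of_mem_Z (hm : 1 < m) (x : T.Y m) (hx : x ∈ T.Z m i) : ρ x = x := by
  refine IntermediateField.algEquiv_eqOn_adjoin (τ := AlgEquiv.refl) ?_ x hx
  rintro _ (⟨n, rfl⟩ | ⟨j, n, hj, rfl⟩)
  · exact hρ.apply_z hm n
  · exact hρ.apply_y_of_ne j n hj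

/-- On its own coset the reflection swaps `y` and `F/y`; the cosets are disjoint, so it fixes the
other `δ`'s. -/
theorem apply_delta (hm : 1 < m) (t : T.Sig i) :
    ρ (T.delta m i t) = if s = t then -T.delta m i t else T.delta m i t := by
  have hY : ρ (T.bigY m i t) =
      if s = t then T.bigF m i t / T.bigY m i t else T.bigY m i t := by
    rw [← prod_reflVar hm, bigY, map_prod]
    exact Finset.prod_congr rfl fun n _ => hρ.apply_y i n
  have hF : ρ (T.bigF m i t) = T.bigF m i t := by
    rw [bigF, map_prod]
    exact Finset.prod_congr rfl fun n _ => map_F hρ.apply_y_of_ne n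
  rw [delta, map_sub, map_div₀, hY, hF]
  split_ifs
  · rw [div_div_cancel₀ (bigF_ne_zero t), neg_sub]
  · rfl

end IsReflection

end NSLType

end

theorem mainTheorem3 (T : NSLType) (m : ℕ) (hm : 1 < m) (i : T.I) :
    (∀ s : T.Sig i, ∃! ρ : T.Y m ≃ₐ[ℂ] T.Y m, T.IsReflection m i s ρ) ∧
    ∀ r : T.Sig i → (T.Y m ≃ₐ[ℂ] T.Y m), (∀ s, T.IsReflection m i s (r s)) →
      (∀ s s', Commute (r s) (r s')) ∧
      (∀ s, orderOf (r s) = 2) ∧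
      (∃ φ : Multiplicative (T.Sig i → ZMod 2) ≃* Subgroup.closure (Set.range r),
        ∀ s, (φ (Multiplicative.ofAdd (Pi.single s 1)) : T.Y m ≃ₐ[ℂ] T.Y m) = r s) ∧
      IntermediateField.fixedField (Subgroup.closure (Set.range r)) = T.Z m i ∧
      IsGalois (T.Z m i) (T.Y m) ∧
      (T.Z m i).fixingSubgroup = Subgroup.closure (Set.range r) ∧
      IntermediateField.adjoin (T.Z m i) (Set.range (T.delta m i)) = ⊤ ∧
      (∀ s, T.delta m i s ^ 2 ∈ T.Z m i) ∧
      (∀ s, r s (T.delta m i s) = -T.delta m i s) := by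
  refine ⟨fun s => ?_, fun r hr => ?_⟩
  · obtain ⟨ρ, hρ⟩ := NSLType.exists_isReflection hm s
    exact ⟨ρ, hρ, fun σ hσ => NSLType.algEquiv_ext_y fun j n => (hσ j n).trans (hρ j n).symm⟩
  have h0 := NSLType.delta_ne_zero (T := T) (m := m) (i := i) hm
  have hsq := NSLType.delta_sq_mem_Z (T := T) (m := m) (i := i) hm
  have htop := NSLType.adjoin_delta_eq_top (T := T) (m := m) (i := i) hm
  have hrZ : ∀ s, ∀ x ∈ T.Z m i, r s x = x := fun s => (hr s).apply_of_mem_Z hm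
  have hrδ : ∀ s t, r s (T.delta m i t) = if s = t then -T.delta m i t else T.delta m i t :=
    fun s t => (hr s).apply_delta hm t
  have : CharZero (T.Y m) := algebraRat.charZero _
  exact ⟨KummerTwo.commute htop hrZ hrδ, KummerTwo.orderOf_eq_two h0 htop hrZ hrδ,
    KummerTwo.exists_mulEquiv h0 hsq htop hrZ hrδ, KummerTwo.fixedField_eq hsq htop hrZ hrδ,
    KummerTwo.isGalois hsq htop, KummerTwo.fixingSubgroup_eq hsq htop hrZ hrδ, htop, hsq,
    fun s => (hrδ s s).trans (if_pos rfl)⟩
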